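/- Let $\mathcal L$ be a first-order language, let $T$ be a complete $\mathcal L$-theory, and let $\mathfrak C\models T$ be a monster model, that is, a $\kappa$-saturated and strongly $\kappa$-homogeneous model for a cardinal $\kappa>|\mathcal L|+\aleph_0$. A model of $T$ is called small if it is an elementary substructure of $\mathfrak C$ of cardinality less than $\kappa$. Let $\varphi(x,y)$ be an $\mathcal L$-formula, where $x$ and $y$ are tuples of variables. The formula $\varphi(x,y)$ is NIP if there is no sequence $(b_n)_{n<\omega}$ of $y$-tuples of $\mathfrak C$ such that for every $I\subseteq\mathbb N$ there is an $x$-tuple $a$ of $\mathfrak C$ with $\mathfrak C\models\varphi(a,b_n)$ if and only if $n\in I$, for all $n$. If a group $G$ acts by homeomorphisms on a compact Hausdorff space $X$, a function $f\in C(X)$ is called tame in $(X,G)$ if $\{f\circ g : g\in G\}$ contains no independent sequence. Here a sequence $(f_n)_{n<\omega}$ in $C(X)$ is independent if there are real numbers $r_1<r_2$ such that for all finite disjoint $P,Q\subseteq\mathbb N$ $$\bigcap_{n\in P} f_n^{-1}[(-\infty,r_1)]\;\cap\;\bigcap_{n\in Q} f_n^{-1}[(r_2,\infty)]\neq\emptyset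 .$$ For $M\models T$, let $S_x(M)$ be the space of complete types over $M$ in the variables $x$, with the natural action of $\operatorname{Aut}(M)$. For a $y$-tuple $b$ of $M$, let $\chi_{[\varphi(x,b)]}$ be the characteristic function of the clopen set $[\varphi(x,b)]=\{p\in S_x(M):\varphi(x,b)\in p\}$. **Lemma.** The following are equivalent. 1. $\varphi(x,y)$ is NIP. 2. For every model $M\models T$ and every $y$-tuple $b$ of $M$, the function $\chi_{[\varphi(x,b)]}$ is tame in $(S_x(M),\operatorname{Aut}(M))$. 3. For every small model $M\models T$ and every $y$-tuple $b$ of $M$, the function $\chi_{[\varphi(x,b)]}$ is tame in $(S_x(M),\operatorname{Aut}(M))$. -/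

import Mathlib

open FirstOrder Cardinal

namespace TameNIP

open FirstOrder.Language

/-! ### Tame functions in a dynamical system -/

section Dynamics

variable {X : Type*} [TopologicalSpace X]

/-- A sequence of continuous real functions on `X` is independent if, for some reals `r₁ < r₂`, for
all finite disjoint `P, Q ⊆ ℕ` some point `x` has `f n x < r₁` for all `n ∈ P` and `r₂ < f n x` for
all `n ∈ Q`. -/
def IsIndependentSeq (f : ℕ → C(X, ℝ)) : Prop :=
  ∃ r₁ r₂ : ℝ, r₁ < r₂ ∧ ∀ P Q : Finset ℕ, Disjoint P Q →
    ((⋂ n ∈ P, f n ⁻¹' Set.Iio r₁) ∩ (⋂ n ∈ Q, f n ⁻¹' Set.Ioi r₂)).Nonempty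

/-- For a group `G` acting on `X` by homeomorphisms, `f ∈ C(X)` is tame in `(X, G)` if the orbit
`{f ∘ g | g ∈ G}` contains no independent sequence. -/
def IsTameFunction (G : Type*) [Group G] [MulAction G X] [ContinuousConstSMul G X]
    (f : C(X, ℝ)) : Prop :=
  ¬ ∃ h : ℕ → C(X, ℝ),
    (∀ n, h n ∈ Set.range fun g : G => f.comp ⟨fun x => g • x, continuous_const_smul g⟩) ∧
      IsIndependentSeq h

end Dynamics

/-! ### The space of types `S_x(M)` with the action of `Aut(M)` -/

section Types

universe u v w

variable {L : FirstOrder.Language.{u, v}} {M : Type w} [L.Structure M]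

/-- The group `Aut(M)`, with composition as multiplication. -/
instance autGroup : Group (M ≃[L] M) where
  mul g h := g.comp h
  one := FirstOrder.Language.Equiv.refl L M
  inv g := g.symm
  mul_assoc _ _ _ := rfl
  one_mul _ := rfl
  mul_one _ := rfl
  inv_mul_cancel g := FirstOrder.Language.Equiv.symm_comp_self g

variable (L M) in
/-- The space `S_x(M)` of complete types over `M` in the variables `x = (x_i)_{i ∈ α}`, that is, of
complete types of the theory of `M` with a constant added for each element. -/
abbrev TypeSpace (α : Type*) := (L.elementaryDiagram M).CompleteType α

variable {α : Type*} {β : Type*}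

/-- The effect of an automorphism `g` of `M` on sentences in the language with constants for the
elements of `M` and for the variables `x`: every parameter `m` is replaced by `g m`. -/
def mapParams (α : Type*) (g : M ≃[L] M) : L[[M]][[α]].Sentence → L[[M]][[α]].Sentence :=
  ((L.lhomWithConstantsMap g).addConstants α).onSentence

lemma lhomWithConstantsMap_comp (g h : M ≃[L] M) :
    (L.lhomWithConstantsMap g).comp (L.lhomWithConstantsMap h) =
      L.lhomWithConstantsMap (g.comp h) := by
  refine LHom.funext ?_ ?_
  · funext n c
    rcases c with c | c
    · rfl
    · cases n with
      | zero => rfl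
      | succ n => exact isEmptyElim c
  · funext n c
    rcases c with c | c
    · rfl
    · exact isEmptyElim c

lemma lhomWithConstantsMap_one :
    L.lhomWithConstantsMap (FirstOrder.Language.Equiv.refl L M) = LHom.id L[[M]] := by
  refine LHom.funext ?_ ?_
  · funext n c
    rcases c with c | c
    · rfl
    · cases n with
      | zero => rfl
      | succ n => exact isEmptyElim c
  · funext n c
    rcases c with c | c
    · rfl
    · exact isEmptyElim c

lemma addConstants_comp {L₁ L₂ L₃ : FirstOrder.Language} (φ : L₂ →ᴸ L₃) (ψ : L₁ →ᴸ L₂) :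
    (φ.addConstants α).comp (ψ.addConstants α) = (φ.comp ψ).addConstants α := by
  refine LHom.funext ?_ ?_ <;>
  · funext n c
    rcases c with c | c <;> rfl

lemma addConstants_id {L₁ : Language} : (LHom.id L₁).addConstants α = LHom.id L₁[[α]] := by
  refine LHom.funext ?_ ?_ <;>
  · funext n c
    rcases c with c | c <;> rfl

lemma onSentence_comp {L₁ L₂ L₃ : FirstOrder.Language} (φ : L₂ →ᴸ L₃) (ψ : L₁ →ᴸ L₂)
    (θ : L₁.Sentence) :
    φ.onSentence (ψ.onSentence θ) = (φ.comp ψ).onSentence θ :=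
  (congrFun (LHom.comp_onBoundedFormula φ ψ) θ).symm

lemma mapParams_comp (g h : M ≃[L] M) (θ : L[[M]][[α]].Sentence) :
    mapParams α g (mapParams α h θ) = mapParams α (g.comp h) θ := by
  rw [mapParams, mapParams, onSentence_comp, addConstants_comp, lhomWithConstantsMap_comp]
  rfl

lemma mapParams_one (θ : L[[M]][[α]].Sentence) :
    mapParams α (FirstOrder.Language.Equiv.refl L M) θ = θ := by
  rw [mapParams, lhomWithConstantsMap_one, addConstants_id]
  exact congrFun LHom.id_onBoundedFormula θ

lemma realize_onSentence_of_equiv {L₁ L₂ : FirstOrder.Language} (φ : L₁ →ᴸ L₂) {N N' : Type*}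
    [L₁.Structure N] [L₂.Structure N'] (e : N ≃ N')
    (hf : ∀ {n} (c : L₁.Functions n) (xs : Fin n → N),
      e (Structure.funMap c xs) = Structure.funMap (φ.onFunction c) (e ∘ xs))
    (hr : ∀ {n} (c : L₁.Relations n) (xs : Fin n → N),
      Structure.RelMap (φ.onRelation c) (e ∘ xs) ↔ Structure.RelMap c xs) (θ : L₁.Sentence) :
    N' ⊨ φ.onSentence θ ↔ N ⊨ θ := by
  let S : L₁.Structure N' := φ.reduct N'
  have : φ.IsExpansionOn N' := φ.isExpansionOn_reduct N'
  let e' : N ≃[L₁] N' := ⟨e, hf, hr⟩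
  rw [LHom.realize_onSentence]
  exact (StrongHomClass.realize_sentence e' θ).symm

/-- Truth in `M` is preserved when the parameters are moved by an automorphism. -/
lemma realize_lhomWithConstantsMap (g : M ≃[L] M) (θ : L[[M]].Sentence) :
    M ⊨ (L.lhomWithConstantsMap g).onSentence θ ↔ M ⊨ θ := by
  refine realize_onSentence_of_equiv _ g.toEquiv ?_ ?_ θ
  · intro n c xs
    rcases c with c | c
    · exact g.map_fun c xs
    · cases n with
      | zero => rfl
      | succ n => exact isEmptyElim c
  · intro n c xs
    rcases c with c | c
    · exact g.map_rel c xs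
    · exact isEmptyElim c

/-- The action of `Aut(M)` on `S_x(M)`: `g • p = {φ(x, g m) | φ(x, m) ∈ p}`. -/
instance typeSpaceSMul : SMul (M ≃[L] M) (TypeSpace L M α) where
  smul g p :=
    { toTheory := {θ | mapParams α g.symm θ ∈ p.toTheory}
      subset' := by
        rintro _ ⟨θ, hθ, rfl⟩
        apply p.subset'
        refine ⟨(L.lhomWithConstantsMap g.symm).onSentence θ, ?_, ?_⟩
        · exact (realize_lhomWithConstantsMap g.symm θ).2 hθ
        · rw [mapParams, onSentence_comp, onSentence_comp]
          congr 1
      isMaximal' := by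
        refine ⟨?_, fun θ => ?_⟩
        · apply Theory.isSatisfiable_of_isSatisfiable_onTheory
            ((L.lhomWithConstantsMap g.symm).addConstants α)
          refine p.isMaximal'.1.mono ?_
          rintro _ ⟨θ, hθ, rfl⟩
          exact hθ
        · exact p.isMaximal'.2 (mapParams α g.symm θ) }

lemma mem_smul_iff (g : M ≃[L] M) (p : TypeSpace L M α) (θ : L[[M]][[α]].Sentence) :
    θ ∈ g • p ↔ mapParams α g.symm θ ∈ p := Iff.rfl

instance typeSpaceMulAction : MulAction (M ≃[L] M) (TypeSpace L M α) where
  one_smul p := SetLike.ext fun θ => by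
    rw [mem_smul_iff]
    exact iff_of_eq (congrArg (· ∈ p) (mapParams_one θ))
  mul_smul g h p := SetLike.ext fun θ => by
    rw [mem_smul_iff, mem_smul_iff, mem_smul_iff, mapParams_comp]
    rfl

instance typeSpaceContinuousConstSMul :
    ContinuousConstSMul (M ≃[L] M) (TypeSpace L M α) where
  continuous_const_smul g := by
    refine continuous_generateFrom_iff.2 ?_
    rintro _ ⟨θ, rfl⟩
    exact _root_.CompleteType.isOpen_typesWith (mapParams α g.symm θ)

/-- The formula `φ(x, b)` with parameters in `M`, as a sentence in the language with constants for
the elements of `M` and for the variables `x`. -/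
def instanceAt (φ : L.Formula (α ⊕ β)) (b : β → M) : L[[M]][[α]].Sentence :=
  Formula.equivSentence
    (BoundedFormula.subst ((L.lhomWithConstants M).onFormula φ)
      (Sum.elim Term.var fun j => (L.con (b j)).term) : L[[M]].Formula α)

/-- The clopen set `[φ(x, b)]` of the types in `S_x(M)` that contain `φ(x, b)`. -/
def clopenSet (φ : L.Formula (α ⊕ β)) (b : β → M) : Set (TypeSpace L M α) :=
  (L.elementaryDiagram M).typesWith (instanceAt φ b)

open Classical in
/-- The characteristic function of `[φ(x, b)]`, a continuous function on `S_x(M)`. -/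
noncomputable def charFun (φ : L.Formula (α ⊕ β)) (b : β → M) : C(TypeSpace L M α, ℝ) where
  toFun := (clopenSet φ b).indicator 1
  continuous_toFun :=
    (IsClopen.continuous_indicator (_root_.CompleteType.isClopen_typesWith _) continuous_const)

end Types

/-! ### Monster models, NIP and tame formulas -/

section Formulas

/-- `C` is `κ`-saturated: every set of formulas in one variable with parameters in a set `A` with
`|A| < κ` that is finitely satisfiable in `C` is realized in `C`. -/
def IsSaturated.{u, v, w} (L : FirstOrder.Language.{u, v}) (C : Type w) [L.Structure C]
    (κ : Cardinal.{w}) : Prop :=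
  ∀ A : Set C, #A < κ → ∀ p : Set (L[[A]].Formula Unit),
    (∀ q : Finset (L[[A]].Formula Unit), (q : Set (L[[A]].Formula Unit)) ⊆ p →
      ∃ c : C, ∀ ψ ∈ q, ψ.Realize fun _ => c) →
    ∃ c : C, ∀ ψ ∈ p, ψ.Realize fun _ => c

/-- `C` is strongly `κ`-homogeneous: every partial elementary map from a set `A ⊆ C` with `|A| < κ`
to `C` extends to an automorphism of `C`. -/
def IsStronglyHomogeneous.{u, v, w} (L : FirstOrder.Language.{u, v}) (C : Type w) [L.Structure C]
    (κ : Cardinal.{w}) : Prop :=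
  ∀ A : Set C, #A < κ → ∀ f : A → C,
    (∀ ψ : L.Formula A, ψ.Realize (fun a => (a : C)) ↔ ψ.Realize f) →
    ∃ σ : C ≃[L] C, ∀ a : A, σ a = f a

/-- `C` is a monster model with respect to a cardinal `κ`, larger than `ℵ₀` and than the number of
symbols of the language. A set is small if its cardinality is less than `κ`. -/
structure IsMonster.{u, v, w} (L : FirstOrder.Language.{u, v}) (C : Type w) [L.Structure C]
    (κ : Cardinal.{w}) : Prop where
  aleph0_lt : ℵ₀ < κ
  card_lt : Cardinal.lift.{w} L.card < Cardinal.lift.{max u v} κ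
  saturated : IsSaturated L C κ
  homogeneous : IsStronglyHomogeneous L C κ

/-- `φ(x, y)` is NIP: there is no sequence `(b_n)` in the monster model `C` such that
`(φ(C, b_n))` is an independent family of sets. -/
def IsNIP.{u, v, w, a, b} {L : FirstOrder.Language.{u, v}} {α : Type a} {β : Type b} (C : Type w)
    [L.Structure C] (φ : L.Formula (α ⊕ β)) : Prop :=
  ¬ ∃ b : ℕ → β → C, ∀ I : Set ℕ, ∃ c : α → C, ∀ n, φ.Realize (Sum.elim c (b n)) ↔ n ∈ I

/-- `φ(x, y)` is tame: for every model `M` of `T` (in a given universe) and every tuple `b` in `M`,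
the characteristic function of `[φ(x, b)]` is tame in `(S_x(M), Aut(M))`. -/
def IsTame.{u, v, w, a, b} {L : FirstOrder.Language.{u, v}} {α : Type a} {β : Type b} (T : L.Theory)
    (φ : L.Formula (α ⊕ β)) : Prop :=
  ∀ (M : Type w) [L.Structure M] [Nonempty M] [M ⊨ T] (b : β → M),
    IsTameFunction (M ≃[L] M) (charFun φ b)

/-- `φ(x, y)` is small-tame: the same for all small models, that is, for all elementary
substructures `M` of the monster model `C` with `|M| < κ`. -/
def IsSmallTame.{u, v, w, a, b} {L : FirstOrder.Language.{u, v}} {α : Type a} {β : Type b} (C : Type w)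
    [L.Structure C] (κ : Cardinal.{w}) (φ : L.Formula (α ⊕ β)) : Prop :=
  ∀ M : L.ElementarySubstructure C, #M < κ → ∀ b : β → M,
    IsTameFunction (M ≃[L] M) (charFun φ b)

end Formulas

end TameNIP

/-! The link between dynamics and combinatorics is `isTameFunction_charFun_iff`: `charFun φ b` fails
to be tame iff there are automorphisms `g n` of `M` for which the sets `φ(M, g n b)` are
independent. A translate of `charFun φ b` takes only the values 0 and 1, and a finite Boolean
combination of instances of `φ` lies in some type over `M` iff it is satisfied in `M`.

NIP implies tameness: the type of an independent family in any model of `T` is realized in `C` by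
saturation, and compactness turns finite independence into a realization for every `I ⊆ ℕ`
(`IsMonster.not_isNIP_of_isIndependentFamily`).

Small-tameness implies NIP: if NIP fails, pigeonhole and compactness give an independent family in
`C` whose members all have one type. Homogeneity supplies automorphisms of `C` carrying the first
member to the others, and Löwenheim–Skolem gives a small model containing the first member and
closed under these maps and their inverses (`IsMonster.exists_small_of_not_isNIP`).

The tuples `x` and `y` may be infinite, so `restrictVars` passes to the finitely many variables that
occur in `φ`. -/

namespace TameNIP

open FirstOrder.Language

/-! ### Independent families of instances of a formula -/

section Patterns

universe u v

variable {L : FirstOrder.Language.{u, v}} {M : Type*} [L.Structure M] {α : Type*} {β : Type*}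

/-- Some `c` satisfies `φ(x, b n)` for all `n ∈ Q` and for no `n ∈ P`. -/
def HasPattern (φ : L.Formula (α ⊕ β)) (b : ℕ → β → M) (P Q : Finset ℕ) : Prop :=
  ∃ c : α → M, (∀ n ∈ P, ¬ φ.Realize (Sum.elim c (b n))) ∧ ∀ n ∈ Q, φ.Realize (Sum.elim c (b n))

/-- The sets `φ(M, b n)` are independent: all finite Boolean combinations are nonempty. -/
def IsIndependentFamily (φ : L.Formula (α ⊕ β)) (b : ℕ → β → M) : Prop :=
  ∀ P Q : Finset ℕ, Disjoint P Q → HasPattern φ b P Q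

lemma IsIndependentFamily.comp_injective {φ : L.Formula (α ⊕ β)} {b : ℕ → β → M}
    (h : IsIndependentFamily φ b) {f : ℕ → ℕ} (hf : f.Injective) :
    IsIndependentFamily φ (fun n => b (f n)) := by
  classical
  intro P Q hPQ
  obtain ⟨c, hP, hQ⟩ := h (P.image f) (Q.image f) ((Finset.disjoint_image hf).2 hPQ)
  exact ⟨c, fun n hn => hP _ (Finset.mem_image_of_mem f hn),
    fun n hn => hQ _ (Finset.mem_image_of_mem f hn)⟩

/-- The formula expressing `HasPattern`. -/
noncomputable def patternFormula [Finite α] (φ : L.Formula (α ⊕ β)) (P Q : Finset ℕ) :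
    L.Formula (ℕ × β) :=
  let ψ (n : ℕ) : L.Formula ((ℕ × β) ⊕ α) :=
    φ.relabel (Sum.elim Sum.inr fun j => Sum.inl (n, j))
  Formula.iExs α (Formula.iInf (fun n : P => (ψ n).not) ⊓ Formula.iInf fun n : Q => ψ n)

lemma realize_patternFormula [Finite α] (φ : L.Formula (α ⊕ β)) (P Q : Finset ℕ)
    (b : ℕ × β → M) :
    (patternFormula φ P Q).Realize b ↔ HasPattern φ (fun n j => b (n, j)) P Q := by
  have key (c : α → M) (n : ℕ) : Sum.elim b c ∘ (Sum.elim Sum.inr fun j => Sum.inl (n, j)) =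
      Sum.elim c fun j => b (n, j) := by
    funext x
    rcases x with x | x <;> rfl
  simp only [patternFormula, Formula.realize_iExs, Formula.realize_inf, Formula.realize_iInf,
    Formula.realize_not, Formula.realize_relabel, key, Subtype.forall, HasPattern]

open Classical in
/-- A formula in the variables `x ⊕ y`, seen as a formula in the finitely many variables that occur
in it. -/
noncomputable def restrictVars (φ : L.Formula (α ⊕ β)) :
    L.Formula (φ.freeVarFinset.toLeft ⊕ φ.freeVarFinset.toRight) :=
  BoundedFormula.restrictFreeVar φ fun
    | ⟨Sum.inl a, h⟩ => Sum.inl ⟨a, Finset.mem_toLeft.2 h⟩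
    | ⟨Sum.inr j, h⟩ => Sum.inr ⟨j, Finset.mem_toRight.2 h⟩

open Classical in
lemma realize_restrictVars (φ : L.Formula (α ⊕ β)) (c : α → M) (b : β → M) :
    (restrictVars φ).Realize (Sum.elim (fun a => c a) fun j => b j) ↔
      φ.Realize (Sum.elim c b) := by
  refine BoundedFormula.realize_restrictFreeVar _ ?_
  rintro ⟨a | j, h⟩ <;> rfl

open Classical in
-- Nonemptiness of `M` lets every tuple on the occurring variables be extended to all of `α`.
lemma hasPattern_restrictVars [Nonempty M] (φ : L.Formula (α ⊕ β)) (b : ℕ → β → M)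
    (P Q : Finset ℕ) :
    HasPattern (restrictVars φ) (fun n j => b n j) P Q ↔ HasPattern φ b P Q := by
  have hs := Subtype.val_injective (p := (· ∈ φ.freeVarFinset.toLeft)).surjective_comp_right
    (γ := M)
  refine hs.exists.trans (exists_congr fun c => ?_)
  simp only [← realize_restrictVars φ c]
  rfl

open Classical in
lemma isIndependentFamily_restrictVars [Nonempty M] (φ : L.Formula (α ⊕ β)) (b : ℕ → β → M) :
    IsIndependentFamily (restrictVars φ) (fun n j => b n j) ↔ IsIndependentFamily φ b :=
  forall₃_congr fun P Q _ => hasPattern_restrictVars φ b P Q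

open Classical in
lemma isNIP_restrictVars [Nonempty M] (φ : L.Formula (α ⊕ β)) :
    IsNIP M (restrictVars φ) ↔ IsNIP M φ := by
  have hα := Subtype.val_injective (p := (· ∈ φ.freeVarFinset.toLeft)).surjective_comp_right
    (γ := M)
  have hβ := (Subtype.val_injective
    (p := (· ∈ φ.freeVarFinset.toRight)).surjective_comp_right (γ := M)).comp_left (α := ℕ)
  refine not_congr (hβ.exists.trans (exists_congr fun b => forall_congr' fun I =>
    hα.exists.trans (exists_congr fun c => forall_congr' fun n => ?_)))
  rw [← realize_restrictVars φ c]
  rfl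

/-- Patterns reflect along elementary embeddings. -/
lemma HasPattern.of_elementaryEmbedding [Nonempty M] {N : Type*} [L.Structure N] [Nonempty N]
    (e : M ↪ₑ[L] N) (φ : L.Formula (α ⊕ β)) {b : ℕ → β → M} {P Q : Finset ℕ}
    (h : HasPattern φ (fun n j => e (b n j)) P Q) : HasPattern φ b P Q := by
  classical
  -- With finitely many `x`-variables, the pattern becomes a first-order formula.
  rw [← hasPattern_restrictVars] at h ⊢
  have := (realize_patternFormula (restrictVars φ) P Q fun x => e (b x.1 x.2)).2 h
  exact (realize_patternFormula (restrictVars φ) P Q fun x => b x.1 x.2).1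
    ((e.map_formula _ _).1 this)

lemma isIndependentFamily_map_equiv {N : Type*} [L.Structure N] (e : M ≃[L] N)
    (φ : L.Formula (α ⊕ β)) {b : ℕ → β → M} (h : IsIndependentFamily φ b) :
    IsIndependentFamily φ fun n j => e (b n j) := by
  intro P Q hPQ
  obtain ⟨c, hP, hQ⟩ := h P Q hPQ
  have key (n : ℕ) : φ.Realize (Sum.elim (fun a => e (c a)) fun j => e (b n j)) ↔
      φ.Realize (Sum.elim c (b n)) := by
    rw [← StrongHomClass.realize_formula e φ]
    refine iff_of_eq (congrArg _ ?_)
    funext x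
    rcases x with x | x <;> rfl
  exact ⟨fun a => e (c a), fun n hn => (key n).not.2 (hP n hn), fun n hn => (key n).2 (hQ n hn)⟩

end Patterns

/-! ### Tameness of the characteristic functions -/

section Tame

universe u v w

variable {L : FirstOrder.Language.{u, v}} {α : Type*} {β : Type*}

lemma realize_instanceAt {M N : Type*} [S : L[[M]][[α]].Structure N] (φ : L.Formula (α ⊕ β))
    (b : β → M) :
    N ⊨ (instanceAt φ b : L[[M]][[α]].Sentence) ↔
      @Formula.Realize L N
        (((L[[M]].lhomWithConstants α).comp (L.lhomWithConstants M)).reduct N) _ φ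
        (Sum.elim (fun a => (L[[M]].con a : N)) fun j =>
          (((L[[M]].lhomWithConstants α).onFunction (L.con (b j)) : L[[M]][[α]].Constants) : N)) := by
  let S₁ : L[[M]].Structure N := (L[[M]].lhomWithConstants α).reduct N
  have : (L[[M]].lhomWithConstants α).IsExpansionOn N :=
    (L[[M]].lhomWithConstants α).isExpansionOn_reduct N
  let S₀ : L.Structure N := ((L[[M]].lhomWithConstants α).comp (L.lhomWithConstants M)).reduct N
  have : (L.lhomWithConstants M).IsExpansionOn N :=
    (L.lhomWithConstants M).isExpansionOn_reduct N
  refine (Formula.realize_equivSentence N _).trans ?_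
  refine BoundedFormula.realize_subst.trans ?_
  refine ((L.lhomWithConstants M).realize_onFormula φ).trans ?_
  refine iff_of_eq (congrArg _ ?_)
  funext x
  rcases x with x | x
  · rfl
  · exact Term.realize_constants

variable {M : Type w} [L.Structure M]

/-- Renaming parameters changes neither the `L`-reduct of `N` nor the constants for `x`, so both
sides evaluate `φ` at the same tuple. Arguing in models avoids commuting the renaming with
substitution. -/
lemma realize_mapParams_instanceAt {N : Type*} [S : L[[M]][[α]].Structure N] (g : M ≃[L] M)
    (φ : L.Formula (α ⊕ β)) (b : β → M) :
    N ⊨ mapParams α g (instanceAt φ b) ↔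
      N ⊨ (instanceAt φ (fun j => g (b j)) : L[[M]][[α]].Sentence) := by
  let f := (L.lhomWithConstantsMap g).addConstants α
  have h : @LHom.IsExpansionOn _ _ f N (f.reduct N) S := f.isExpansionOn_reduct N
  refine (@LHom.realize_onSentence _ _ N (f.reduct N) S f h (instanceAt φ b)).trans ?_
  have h₁ := realize_instanceAt (S := f.reduct N) φ b
  have h₂ := realize_instanceAt (S := S) φ fun j => g (b j)
  exact h₁.trans h₂.symm

lemma instanceAt_mem_smul (g : M ≃[L] M) (p : TypeSpace L M α) (φ : L.Formula (α ⊕ β))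
    (b : β → M) : instanceAt φ b ∈ g • p ↔ instanceAt φ (fun j => g.symm (b j)) ∈ p := by
  rw [mem_smul_iff, ← SetLike.mem_coe, ← SetLike.mem_coe, p.isMaximal.mem_iff_models,
    p.isMaximal.mem_iff_models, Theory.models_sentence_iff, Theory.models_sentence_iff]
  exact forall_congr' fun N => realize_mapParams_instanceAt g.symm φ b

lemma instanceAt_mem_typeOf {N : Type*} [L[[M]].Structure N] [L.Structure N] [Nonempty N]
    [(L.lhomWithConstants M).IsExpansionOn N] [N ⊨ L.elementaryDiagram M] (c : α → N)
    (φ : L.Formula (α ⊕ β)) (b : β → M) :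
    instanceAt φ b ∈ (L.elementaryDiagram M).typeOf c ↔
      φ.Realize (Sum.elim c fun j => (L.con (b j) : N)) := by
  refine Theory.CompleteType.formula_mem_typeOf.trans ?_
  refine BoundedFormula.realize_subst.trans ?_
  refine ((L.lhomWithConstants M).realize_onFormula φ).trans ?_
  refine iff_of_eq (congrArg _ ?_)
  funext x
  rcases x with x | x
  · rfl
  · exact Term.realize_constants

/-- A type over `M` is realized in an elementary extension, from which finite patterns reflect to
`M`; conversely a tuple of `M` has a type. -/
lemma exists_type_iff_hasPattern [Nonempty M] (φ : L.Formula (α ⊕ β)) (b : ℕ → β → M)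
    (P Q : Finset ℕ) :
    (∃ p : TypeSpace L M α, (∀ n ∈ P, instanceAt φ (b n) ∉ p) ∧ ∀ n ∈ Q, instanceAt φ (b n) ∈ p) ↔
      HasPattern φ b P Q := by
  constructor
  · rintro ⟨p, hP, hQ⟩
    obtain ⟨N, c, rfl⟩ := Theory.exists_modelType_is_realized_in _ p
    let S : L.Structure N := (L.lhomWithConstants M).reduct N
    have : (L.lhomWithConstants M).IsExpansionOn N := (L.lhomWithConstants M).isExpansionOn_reduct N
    refine HasPattern.of_elementaryEmbedding (ElementaryEmbedding.ofModelsElementaryDiagram L M N)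
      φ ⟨c, fun n hn h => hP n hn ?_, fun n hn => ?_⟩
    · exact (instanceAt_mem_typeOf c φ (b n)).2 h
    · exact (instanceAt_mem_typeOf c φ (b n)).1 (hQ n hn)
  · rintro ⟨c, hP, hQ⟩
    exact ⟨(L.elementaryDiagram M).typeOf c,
      fun n hn => (instanceAt_mem_typeOf c φ (b n)).not.2 (hP n hn),
      fun n hn => (instanceAt_mem_typeOf c φ (b n)).2 (hQ n hn)⟩

lemma charFun_smul_eq_one_or_zero (φ : L.Formula (α ⊕ β)) (b : β → M) (g : M ≃[L] M)
    (p : TypeSpace L M α) :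
    instanceAt φ (fun j => g.symm (b j)) ∈ p ∧ charFun φ b (g • p) = 1 ∨
      instanceAt φ (fun j => g.symm (b j)) ∉ p ∧ charFun φ b (g • p) = 0 := by
  rw [← instanceAt_mem_smul]
  by_cases h : instanceAt φ b ∈ g • p
  · exact Or.inl ⟨h, Set.indicator_of_mem (s := clopenSet φ b) h 1⟩
  · exact Or.inr ⟨h, Set.indicator_of_notMem (s := clopenSet φ b) h 1⟩

/-- Translates of the characteristic function of `[φ(x, b)]` are independent iff the corresponding
instances of `φ` are independent in `M`. -/
lemma isIndependentSeq_charFun_iff [Nonempty M] (φ : L.Formula (α ⊕ β)) (b : β → M)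
    (g : ℕ → (M ≃[L] M)) (f : ℕ → C(TypeSpace L M α, ℝ))
    (hf : ∀ n p, f n p = charFun φ b (g n • p)) :
    IsIndependentSeq f ↔ IsIndependentFamily φ fun n j => (g n).symm (b j) := by
  simp only [IsIndependentSeq, IsIndependentFamily, ← exists_type_iff_hasPattern,
    Set.Nonempty, Set.mem_inter_iff, Set.mem_iInter, Set.mem_preimage, Set.mem_Iio, Set.mem_Ioi, hf]
  constructor
  · rintro ⟨r₁, r₂, hr, h⟩
    -- Some 0/1 value lies below `r₁` and some lies above `r₂`, so both thresholds are in `(0, 1)`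
    -- and separate the two values.
    have h₁ : 0 < r₁ := by
      obtain ⟨p, hp, -⟩ := h {0} ∅ (by simp)
      have := hp 0 (by simp)
      rcases charFun_smul_eq_one_or_zero φ b (g 0) p with h | h <;> linarith
    have h₂ : r₂ < 1 := by
      obtain ⟨p, -, hp⟩ := h ∅ {0} (by simp)
      have := hp 0 (by simp)
      rcases charFun_smul_eq_one_or_zero φ b (g 0) p with h | h <;> linarith
    intro P Q hPQ
    obtain ⟨p, hP, hQ⟩ := h P Q hPQ
    refine ⟨p, fun n hn => ?_, fun n hn => ?_⟩
    · rcases charFun_smul_eq_one_or_zero φ b (g n) p with h | h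
      · linarith [hP n hn]
      · exact h.1
    · rcases charFun_smul_eq_one_or_zero φ b (g n) p with h | h
      · exact h.1
      · linarith [hQ n hn]
  · intro h
    refine ⟨1 / 3, 2 / 3, by norm_num, fun P Q hPQ => ?_⟩
    obtain ⟨p, hP, hQ⟩ := h P Q hPQ
    refine ⟨p, fun n hn => ?_, fun n hn => ?_⟩
    · rcases charFun_smul_eq_one_or_zero φ b (g n) p with h | h
      · exact absurd h.1 (hP n hn)
      · norm_num [h.2]
    · rcases charFun_smul_eq_one_or_zero φ b (g n) p with h | h
      · norm_num [h.2]
      · exact absurd (hQ n hn) h.1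

/-- Composing with `g` replaces `b` by `g⁻¹ b`; as the sequence of automorphisms is arbitrary,
inverses can be dropped. -/
lemma isTameFunction_charFun_iff [Nonempty M] (φ : L.Formula (α ⊕ β)) (b : β → M) :
    IsTameFunction (M ≃[L] M) (charFun φ b) ↔
      ¬ ∃ g : ℕ → (M ≃[L] M), IsIndependentFamily φ fun n j => g n (b j) := by
  refine not_congr ⟨?_, ?_⟩
  · rintro ⟨f, hf, hi⟩
    choose g hg using hf
    refine ⟨fun n => (g n).symm, (isIndependentSeq_charFun_iff φ b g f fun n p => ?_).1 hi⟩
    rw [← hg n]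
    rfl
  · rintro ⟨g, hg⟩
    exact ⟨fun n => (charFun φ b).comp ⟨fun p => (g n).symm • p, continuous_const_smul _⟩,
      fun n => ⟨(g n).symm, rfl⟩,
      (isIndependentSeq_charFun_iff φ b (fun n => (g n).symm) _ fun n p => rfl).2 hg⟩

end Tame

/-! ### Realizing types in a monster model -/

section Monster

universe u v w

variable {L : FirstOrder.Language.{u, v}} {C : Type w} [L.Structure C] {κ : Cardinal.{w}}

/-- Two tuples, possibly in different structures, have the same type over the empty set. -/
def SameType (L : FirstOrder.Language.{u, v}) {γ M N : Type*} [L.Structure M] [L.Structure N]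
    (c : γ → M) (d : γ → N) : Prop :=
  ∀ ψ : L.Formula γ, ψ.Realize c ↔ ψ.Realize d

lemma SameType.comp {γ δ M N : Type*} [L.Structure M] [L.Structure N] {c : γ → M} {d : γ → N}
    (h : SameType L c d) (f : δ → γ) : SameType L (c ∘ f) (d ∘ f) := fun ψ => by
  simpa only [Formula.realize_relabel] using h (ψ.relabel f)

lemma sameType_of_imp {γ M N : Type*} [L.Structure M] [L.Structure N] {c : γ → M} {d : γ → N}
    (h : ∀ ψ : L.Formula γ, ψ.Realize c → ψ.Realize d) : SameType L c d := fun ψ =>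
  ⟨h ψ, fun hd => by_contra fun hc => h ψ.not hc hd⟩

/-- The type of a tuple depends only on its finite subtuples. -/
lemma sameType_nat_of_fin {M N : Type*} [L.Structure M] [L.Structure N] {c : ℕ → M} {d : ℕ → N}
    (h : ∀ n, SameType L (fun i : Fin n => c i) fun i : Fin n => d i) : SameType L c d := by
  intro ψ
  have hlt (i : ψ.freeVarFinset) : (i : ℕ) < ψ.freeVarFinset.sup id + 1 :=
    Nat.lt_succ_of_le (Finset.le_sup (f := id) i.2)
  let f (i : ψ.freeVarFinset) : Fin (ψ.freeVarFinset.sup id + 1) := ⟨i, hlt i⟩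
  exact (BoundedFormula.realize_restrictFreeVar (f := f) c fun _ => rfl).symm.trans
    ((h _ (BoundedFormula.restrictFreeVar ψ f)).trans
      (BoundedFormula.realize_restrictFreeVar d fun _ => rfl))

lemma sameType_of_isEmpty {γ M N : Type*} [L.Structure M] [L.Structure N] [IsEmpty γ]
    (h : M ≅[L] N) (c : γ → M) (d : γ → N) : SameType L c d := by
  intro ψ
  have := h.realize_sentence (ψ.relabel (isEmptyElim : γ → Empty))
  simp only [Sentence.Realize, Formula.realize_relabel] at this
  convert this

lemma mk_range_lt_of_countable (hκ : ℵ₀ < κ) {γ : Type*} [Countable γ] (c : γ → C) :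
    #(Set.range c) < κ :=
  (Cardinal.le_aleph0_iff_set_countable.2 (Set.countable_range c)).trans_lt hκ

/-- The formula `ψ(c, x)`, with the parameters `c`. -/
def withParams {γ : Type*} (c : γ → C) (ψ : L.Formula (γ ⊕ Unit)) :
    L[[Set.range c]].Formula Unit :=
  BoundedFormula.subst ((L.lhomWithConstants (Set.range c)).onFormula ψ)
    (Sum.elim (fun i => (L.con (⟨c i, i, rfl⟩ : Set.range c)).term) Term.var)

lemma realize_withParams {γ : Type*} (c : γ → C) (ψ : L.Formula (γ ⊕ Unit)) (x : C) :
    (withParams c ψ).Realize (fun _ => x) ↔ ψ.Realize (Sum.elim c fun _ => x) := by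
  refine BoundedFormula.realize_subst.trans ?_
  refine ((L.lhomWithConstants (Set.range c)).realize_onFormula ψ).trans ?_
  refine iff_of_eq (congrArg _ ?_)
  funext i
  rcases i with i | i
  · exact Term.realize_con
  · rfl

/-- A small tuple of a saturated model with the type of `d` can be prolonged by an element so that
it gets the type of a given prolongation of `d`. -/
lemma IsSaturated.exists_sameType_sumElim (hC : IsSaturated L C κ) {γ N : Type*} [L.Structure N]
    {c : γ → C} {d : γ → N} (hc : #(Set.range c) < κ) (h : SameType L c d) (y : N) :
    ∃ x : C, SameType L (Sum.elim c fun _ : Unit => x) (Sum.elim d fun _ => y) := by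
  classical
  obtain ⟨x, hx⟩ := hC (Set.range c) hc
    (withParams c '' {ψ | ψ.Realize (Sum.elim d fun _ => y)}) (by
      intro q hq
      obtain ⟨t, ht, rfl⟩ := Finset.subset_set_image_iff.1 hq
      -- The existential closure of the finite fragment holds of `d`, hence of `c`.
      let θ : L.Formula γ := Formula.iExs Unit (Formula.iInf fun ψ : t => (ψ : L.Formula _))
      have hθ : θ.Realize d := by
        simp only [θ, Formula.realize_iExs, Formula.realize_iInf]
        exact ⟨fun _ => y, fun ψ => ht ψ.2⟩
      obtain ⟨x, hx⟩ := Formula.realize_iExs.1 ((h θ).2 hθ)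
      refine ⟨x (), fun ψ' hψ' => ?_⟩
      obtain ⟨ψ, hψ, rfl⟩ := Finset.mem_image.1 hψ'
      exact (realize_withParams c ψ (x ())).2 (Formula.realize_iInf.1 hx ⟨ψ, hψ⟩))
  refine ⟨x, fun ψ => (sameType_of_imp (fun ψ hψ => ?_) ψ).symm⟩
  exact (realize_withParams c ψ x).1 (hx _ ⟨ψ, hψ, rfl⟩)

/-- A saturated model contains a copy of every sequence of every elementarily equivalent model. -/
lemma IsSaturated.exists_sameType_nat (hC : IsSaturated L C κ) (hκ : ℵ₀ < κ) [Nonempty C]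
    {N : Type*} [L.Structure N] (h : C ≅[L] N) (d : ℕ → N) :
    ∃ c : ℕ → C, SameType L c d := by
  classical
  -- Only the first `n` entries matter at stage `n`; the others are placeholders.
  let Good (n : ℕ) (c : ℕ → C) : Prop := SameType L (fun i : Fin n => c i) fun i : Fin n => d i
  have step (n : ℕ) (c : ℕ → C) (hc : Good n c) : ∃ x, Good (n + 1) (Function.update c n x) := by
    obtain ⟨x, hx⟩ := hC.exists_sameType_sumElim (mk_range_lt_of_countable hκ _) hc (d n)
    refine ⟨x, ?_⟩
    convert hx.comp (Fin.lastCases (Sum.inr ()) Sum.inl : Fin (n + 1) → Fin n ⊕ Unit) using 1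
    · funext i
      refine Fin.lastCases ?_ (fun i => ?_) i
      · simp
      · simp [Function.update_of_ne i.2.ne]
    · funext i
      refine Fin.lastCases ?_ (fun i => ?_) i <;> simp
  choose x hx using step
  have zero : Good 0 fun _ => Classical.arbitrary C := sameType_of_isEmpty h _ _
  let F : (n : ℕ) → {c : ℕ → C // Good n c} := fun n =>
    Nat.rec ⟨fun _ => Classical.arbitrary C, zero⟩ (fun n c => ⟨_, hx n c.1 c.2⟩) n
  have hF (n m i : ℕ) (hi : i < n) (hnm : n ≤ m) : (F m).1 i = (F n).1 i := by
    induction m, hnm using Nat.le_induction with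
    | base => rfl
    | succ m hm ih =>
      rw [← ih]
      exact Function.update_of_ne (hi.trans_le hm).ne _ _
  -- Entry `n` is chosen in passing to stage `n + 1` and never changes afterwards.
  refine ⟨fun n => (F (n + 1)).1 n, sameType_nat_of_fin fun n => ?_⟩
  convert (F n).2 using 1
  funext i
  exact (hF (i + 1) n i (Nat.lt_succ_self _) i.2).symm

lemma IsSaturated.exists_sameType (hC : IsSaturated L C κ) (hκ : ℵ₀ < κ) [Nonempty C]
    {N : Type*} [L.Structure N] (h : C ≅[L] N) {γ : Type*} [Countable γ]
    (d : γ → N) : ∃ c : γ → C, SameType L c d := by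
  rcases isEmpty_or_nonempty γ with hγ | hγ
  · exact ⟨isEmptyElim, sameType_of_isEmpty h _ _⟩
  · obtain ⟨f, hf⟩ := exists_surjective_nat γ
    obtain ⟨c, hc⟩ := hC.exists_sameType_nat hκ h (d ∘ f)
    refine ⟨c ∘ Function.surjInv hf, ?_⟩
    convert hc.comp (Function.surjInv hf) using 1
    funext i
    exact congrArg d (Function.surjInv_eq hf i).symm

/-- Compactness in a saturated model, for countably many variables. -/
lemma IsSaturated.exists_realize (hC : IsSaturated L C κ) (hκ : ℵ₀ < κ) [Nonempty C]
    {γ : Type*} [Countable γ] (p : Set (L.Formula γ))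
    (hp : ∀ q : Finset (L.Formula γ), ↑q ⊆ p → ∃ c : γ → C, ∀ ψ ∈ q, ψ.Realize c) :
    ∃ c : γ → C, ∀ ψ ∈ p, ψ.Realize c := by
  classical
  -- A tuple satisfying `p` is found in some model of the complete theory of `C`, then copied into
  -- `C`.
  have hsat : ((L.lhomWithConstants γ).onTheory (L.completeTheory C) ∪
      Formula.equivSentence '' p).IsSatisfiable := by
    rw [Theory.isSatisfiable_iff_isFinitelySatisfiable]
    intro T₀ hT₀
    obtain ⟨c, hc⟩ := hp ((T₀.image Formula.equivSentence.symm).filter (· ∈ p))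
      fun ψ hψ => (Finset.mem_filter.1 hψ).2
    let _ : (constantsOn γ).Structure C := constantsOn.structure c
    have : C ⊨ (T₀ : L[[γ]].Theory) := by
      refine ⟨fun θ hθ => ?_⟩
      rcases hT₀ hθ with h | ⟨ψ, h, rfl⟩
      · have : C ⊨ (L.lhomWithConstants γ).onTheory (L.completeTheory C) :=
          (LHom.onTheory_model _ _).2 inferInstance
        exact Theory.realize_sentence_of_mem _ h
      · refine (Formula.realize_equivSentence C ψ).2 (hc ψ (Finset.mem_filter.2 ⟨?_, h⟩))
        exact Finset.mem_image.2 ⟨_, hθ, Equiv.symm_apply_apply _ _⟩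
    exact Theory.Model.isSatisfiable C
  obtain ⟨N⟩ := hsat
  let S : L.Structure N := (L.lhomWithConstants γ).reduct N
  have : (L.lhomWithConstants γ).IsExpansionOn N := (L.lhomWithConstants γ).isExpansionOn_reduct N
  have h₁ : N ⊨ (L.lhomWithConstants γ).onTheory (L.completeTheory C) :=
    N.is_model.mono Set.subset_union_left
  have h₂ : N ⊨ L.completeTheory C := (LHom.onTheory_model _ _).1 h₁
  have hCN : C ≅[L] N :=
    (completeTheory.isComplete L C).models_elementarily_equivalent C N
  obtain ⟨c, hc⟩ := hC.exists_sameType hκ hCN fun i => ((L.con i : L[[γ]].Constants) : N)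
  refine ⟨c, fun ψ hψ => (hc ψ).2 ((Formula.realize_equivSentence N ψ).1 ?_)⟩
  exact N.is_model.realize_of_mem _ (Or.inr ⟨ψ, hψ, rfl⟩)

/-- Small tuples with the same type are conjugate. -/
lemma IsStronglyHomogeneous.exists_equiv (hC : IsStronglyHomogeneous L C κ) {γ : Type*}
    {c d : γ → C} (hc : #(Set.range c) < κ) (h : SameType L c d) :
    ∃ σ : C ≃[L] C, ∀ i, σ (c i) = d i := by
  choose s hs using fun a : Set.range c => a.2
  obtain ⟨σ, hσ⟩ := hC (Set.range c) hc (d ∘ s) fun ψ => by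
    convert h.comp s ψ using 2
    funext a
    exact (hs a).symm
  refine ⟨σ, fun i => (hσ ⟨c i, i, rfl⟩).trans ?_⟩
  -- Equalities between entries belong to the type, so the choice of index `s` does not matter.
  have := h (Term.equal (Term.var (s ⟨c i, i, rfl⟩)) (Term.var i))
  simp only [Formula.realize_equal, Term.realize_var] at this
  exact this.1 (hs _)

/-- Compactness in a monster model, with countably many parameters and variables. -/
lemma IsMonster.exists_realize (hC : IsMonster L C κ) [Nonempty C] {γ δ : Type*} [Countable γ]
    [Countable δ] (b : γ → C) (p : Set (L.Formula (γ ⊕ δ)))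
    (hp : ∀ q : Finset (L.Formula (γ ⊕ δ)), ↑q ⊆ p →
      ∃ c : δ → C, ∀ ψ ∈ q, ψ.Realize (Sum.elim b c)) :
    ∃ c : δ → C, ∀ ψ ∈ p, ψ.Realize (Sum.elim b c) := by
  classical
  -- The parameters become variables constrained by the complete type of `b`; an automorphism then
  -- moves their realization back to `b`.
  let p' : Set (L.Formula (γ ⊕ δ)) := p ∪ Formula.relabel Sum.inl '' {ψ : L.Formula γ | ψ.Realize b}
  obtain ⟨c, hc⟩ := hC.saturated.exists_realize hC.aleph0_lt p' (by
    intro q hq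
    obtain ⟨c, hc⟩ := hp (q.filter (· ∈ p)) (fun ψ hψ => (Finset.mem_filter.1 hψ).2)
    refine ⟨Sum.elim b c, fun ψ hψ => ?_⟩
    rcases hq hψ with h | ⟨ψ, h, rfl⟩
    · exact hc ψ (Finset.mem_filter.2 ⟨hψ, h⟩)
    · exact Formula.realize_relabel.2 h)
  have hb : SameType L (c ∘ Sum.inl) b := fun ψ =>
    (sameType_of_imp (fun ψ hψ => Formula.realize_relabel.1
      (hc _ (Or.inr ⟨ψ, hψ, rfl⟩))) ψ).symm
  obtain ⟨σ, hσ⟩ := hC.homogeneous.exists_equiv (mk_range_lt_of_countable hC.aleph0_lt _) hb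
  refine ⟨fun i => σ (c (Sum.inr i)), fun ψ hψ => ?_⟩
  have := (StrongHomClass.realize_formula σ ψ).2 (hc ψ (Or.inl hψ))
  convert this using 2
  funext i
  rcases i with i | i
  · exact (hσ i).symm
  · rfl

end Monster

/-! ### Small models closed under countably many maps -/

section SmallModels

universe u v w

/-- The language with one unary function symbol for each element of `ι`. -/
def unaryLanguage (ι : Type) : FirstOrder.Language.{0, 0} where
  Functions n := {_i : ι // n = 1}
  Relations _ := Empty

lemma card_unaryLanguage_le (ι : Type) [Countable ι] : (unaryLanguage ι).card ≤ ℵ₀ := by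
  have (n : ℕ) : Countable ((unaryLanguage ι).Functions n) :=
    inferInstanceAs (Countable {_i : ι // n = 1})
  have (n : ℕ) : Countable ((unaryLanguage ι).Relations n) :=
    inferInstanceAs (Countable Empty)
  exact Cardinal.mk_le_aleph0_iff.2 (inferInstanceAs (Countable (_ ⊕ _)))

/-- The interpretation of the symbols of `unaryLanguage ι` by the maps `f i`. -/
abbrev unaryStructure {ι : Type} {C : Type*} (f : ι → C → C) : (unaryLanguage ι).Structure C where
  funMap i xs := f i.1 (xs ⟨0, i.2 ▸ Nat.one_pos⟩)
  RelMap r _ := r.elim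

variable {L : FirstOrder.Language.{u, v}} {C : Type w} [L.Structure C] {κ : Cardinal.{w}}

lemma isElementary_substructureReduct {L' : FirstOrder.Language} [L'.Structure C]
    (ϕ : L →ᴸ L') [ϕ.IsExpansionOn C] (S : L'.ElementarySubstructure C) :
    (ϕ.substructureReduct S.toSubstructure).IsElementary := by
  intro n ψ x
  have h := S.isElementary (ϕ.onFormula ψ) x
  let _ : L.Structure S := (ϕ.substructureReduct S.toSubstructure).inducedStructure
  have : ϕ.IsExpansionOn S :=
    ⟨fun f xs => Subtype.ext (ϕ.map_onFunction f fun i => (xs i : C)),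
      fun R xs => ϕ.map_onRelation R fun i => (xs i : C)⟩
  rw [ϕ.realize_onFormula] at h
  exact h.trans (ϕ.realize_onFormula ψ)

/-- The downward Löwenheim–Skolem theorem, with closure under countably many maps. -/
lemma IsMonster.exists_small_closed (hC : IsMonster L C κ) {ι : Type} [Countable ι]
    (f : ι → C → C) (s : Set C) (hs : s.Countable) :
    ∃ M : L.ElementarySubstructure C, #M < κ ∧ s ⊆ M ∧ ∀ i, ∀ x ∈ M, f i x ∈ M := by
  obtain ⟨μ, hμ⟩ : ∃ μ : Cardinal.{w}, Cardinal.lift.{max u v} μ = Cardinal.lift.{w} L.card :=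
    Cardinal.mem_range_lift_of_le hC.card_lt.le
  have hμκ : μ < κ := by
    have := hC.card_lt
    rwa [← hμ, Cardinal.lift_lt] at this
  -- Löwenheim–Skolem needs a target cardinal at most `#C`; otherwise `C` itself is small.
  rcases le_total #C (max ℵ₀ μ) with h | h
  · exact ⟨⊤, (Cardinal.mk_univ.trans_le h).trans_lt (max_lt hC.aleph0_lt hμκ),
      Set.subset_univ s, fun _ _ _ => Set.mem_univ _⟩
  -- Once the maps are function symbols, every substructure is closed under them.
  · let _ := unaryStructure f
    obtain ⟨S, hsS, hS⟩ := exists_elementarySubstructure_card_eq (L.sum (unaryLanguage ι)) s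
      (max ℵ₀ μ) (le_max_left _ _)
      (Cardinal.lift_le.2 ((Cardinal.le_aleph0_iff_set_countable.2 hs).trans (le_max_left _ _)))
      (by
        rw [Language.card_sum]
        simp only [Cardinal.lift_add, Cardinal.lift_max, Cardinal.lift_lift, Cardinal.lift_aleph0]
        refine Cardinal.add_le_of_le (le_max_left _ _) ?_ ?_
        · exact le_max_of_le_right hμ.ge
        · refine le_max_of_le_left ?_
          exact (Cardinal.lift_le.2 (card_unaryLanguage_le ι)).trans_eq Cardinal.lift_aleph0)
      (Cardinal.lift_le.2 h)
    refine ⟨⟨LHom.sumInl.substructureReduct S.toSubstructure,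
      isElementary_substructureReduct LHom.sumInl S⟩, ?_, hsS, fun i x hx => ?_⟩
    · exact (Cardinal.lift_injective hS).trans_lt (max_lt hC.aleph0_lt hμκ)
    · exact S.toSubstructure.fun_mem
        (Sum.inr ⟨i, rfl⟩ : (L.sum (unaryLanguage ι)).Functions 1) (fun _ => x) fun _ => hx

/-- An automorphism that preserves an elementary substructure in both directions restricts to it. -/
def restrictEquiv (M : L.ElementarySubstructure C) (σ : C ≃[L] C) (h₁ : ∀ x ∈ M, σ x ∈ M)
    (h₂ : ∀ x ∈ M, σ.symm x ∈ M) : M ≃[L] M where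
  toFun x := ⟨σ x, h₁ x x.2⟩
  invFun x := ⟨σ.symm x, h₂ x x.2⟩
  left_inv x := Subtype.ext (σ.symm_apply_apply x)
  right_inv x := Subtype.ext (σ.apply_symm_apply x)
  map_fun' c xs := Subtype.ext (σ.map_fun c fun i => (xs i : C))
  map_rel' r xs := σ.map_rel r fun i => (xs i : C)

end SmallModels

/-! ### NIP and independent families -/

section Main

universe u v w

variable {L : FirstOrder.Language.{u, v}} {C : Type w} [L.Structure C]
  {κ : Cardinal.{w}} {α β : Type*}

lemma exists_isIndependentFamily_of_not_isNIP {φ : L.Formula (α ⊕ β)} (h : ¬ IsNIP C φ) :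
    ∃ b : ℕ → β → C, IsIndependentFamily φ b := by
  obtain ⟨b, hb⟩ := not_not.1 h
  refine ⟨b, fun P Q hPQ => ?_⟩
  obtain ⟨c, hc⟩ := hb Q
  exact ⟨c, fun n hn => (hc n).not.2 (Finset.disjoint_left.1 hPQ hn), fun n hn => (hc n).2 hn⟩

variable [Nonempty C]

lemma IsMonster.not_isNIP_of_isIndependentFamily_self (hC : IsMonster L C κ) [Countable α]
    [Countable β] {φ : L.Formula (α ⊕ β)} {b : ℕ → β → C} (h : IsIndependentFamily φ b) :
    ¬ IsNIP C φ := by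
  classical
  refine not_not.2 ⟨b, fun I => ?_⟩
  let ψ (n : ℕ) : L.Formula ((ℕ × β) ⊕ α) :=
    φ.relabel (Sum.elim Sum.inr fun j => Sum.inl (n, j))
  have key (c : α → C) (n : ℕ) : (ψ n).Realize (Sum.elim (fun x => b x.1 x.2) c) ↔
      φ.Realize (Sum.elim c (b n)) := by
    refine Formula.realize_relabel.trans (iff_of_eq (congrArg _ ?_))
    funext x
    rcases x with x | x <;> rfl
  -- Finite parts of this set are patterns with `P` outside `I` and `Q` inside `I`.
  let F (n : ℕ) : L.Formula ((ℕ × β) ⊕ α) := if n ∈ I then ψ n else (ψ n).not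
  obtain ⟨c, hc⟩ := hC.exists_realize (fun x : ℕ × β => b x.1 x.2) (F '' Set.univ) (by
    intro q hq
    obtain ⟨t, -, rfl⟩ := Finset.subset_set_image_iff.1 hq
    obtain ⟨c, hP, hQ⟩ := h (t.filter (· ∉ I)) (t.filter (· ∈ I))
      (Finset.disjoint_filter_filter_not t t _).symm
    refine ⟨c, fun θ hθ => ?_⟩
    obtain ⟨n, hn, rfl⟩ := Finset.mem_image.1 hθ
    by_cases hI : n ∈ I
    · simpa only [F, hI, if_true, key] using hQ n (Finset.mem_filter.2 ⟨hn, hI⟩)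
    · simpa only [F, hI, if_false, Formula.realize_not, key] using
        hP n (Finset.mem_filter.2 ⟨hn, hI⟩))
  refine ⟨c, fun n => ?_⟩
  have := hc _ ⟨n, trivial, rfl⟩
  by_cases hI : n ∈ I
  · simpa only [F, hI, if_true, key, iff_true] using this
  · simpa only [F, hI, if_false, Formula.realize_not, key, iff_false] using this

/-- An independent family in some model yields one in the monster model. -/
lemma IsMonster.not_isNIP_of_isIndependentFamily (hC : IsMonster L C κ) {N : Type*}
    [L.Structure N] [Nonempty N] (hN : C ≅[L] N) {φ : L.Formula (α ⊕ β)} {b : ℕ → β → N}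
    (h : IsIndependentFamily φ b) : ¬ IsNIP C φ := by
  classical
  rw [← isNIP_restrictVars]
  rw [← isIndependentFamily_restrictVars] at h
  obtain ⟨c, hc⟩ := hC.saturated.exists_sameType hC.aleph0_lt hN
    fun x : ℕ × φ.freeVarFinset.toRight => b x.1 x.2
  refine hC.not_isNIP_of_isIndependentFamily_self (b := fun n j => c (n, j)) fun P Q hPQ => ?_
  exact (realize_patternFormula _ P Q c).1 ((hc _).2 ((realize_patternFormula _ P Q _).2
    (h P Q hPQ)))

/-- In the monster model, an independent family can be replaced by one whose members all have the
same type. -/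
lemma IsMonster.exists_isIndependentFamily_sameType (hC : IsMonster L C κ) [Finite α]
    [Countable β] {φ : L.Formula (α ⊕ β)} {b : ℕ → β → C} (h : IsIndependentFamily φ b) :
    ∃ c : ℕ → β → C, IsIndependentFamily φ c ∧ ∀ n, SameType L (c 0) (c n) := by
  classical
  -- The left summand encodes independence, the right one that members `0` and `n` agree on each
  -- formula.
  let F : {x : Finset ℕ × Finset ℕ // Disjoint x.1 x.2} ⊕ (ℕ × L.Formula β) →
      L.Formula (ℕ × β) :=
    Sum.elim (fun x => patternFormula φ x.1.1 x.1.2)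
      fun x => (x.2.relabel (Prod.mk 0)).iff (x.2.relabel (Prod.mk x.1))
  obtain ⟨c, hc⟩ := hC.saturated.exists_realize hC.aleph0_lt (F '' Set.univ) (by
    intro q hq
    obtain ⟨t, -, rfl⟩ := Finset.subset_set_image_iff.1 hq
    let Ψ : Finset (L.Formula β) := t.toRight.image Prod.snd
    -- Only the finitely many formulas in `Ψ` must be respected, so infinitely many `b n` share one
    -- truth pattern. That subsequence is still independent.
    let f (n : ℕ) (ψ : Ψ) : Prop := (ψ : L.Formula β).Realize (b n)
    obtain ⟨y, hy⟩ := Finite.exists_infinite_fiber f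
    let e := Nat.orderEmbeddingOfSet (f ⁻¹' {y})
    have he (n : ℕ) : f (e n) = y := (Nat.Subtype.ofNat (f ⁻¹' {y}) n).2
    refine ⟨fun x => b (e x.1) x.2, fun θ hθ => ?_⟩
    obtain ⟨x, hx, rfl⟩ := Finset.mem_image.1 hθ
    rcases x with ⟨⟨P, Q⟩, hPQ⟩ | ⟨n, ψ⟩
    · exact (realize_patternFormula _ _ _ _).2 (h.comp_injective e.injective P Q hPQ)
    · have hψ : ψ ∈ Ψ := Finset.mem_image.2 ⟨(n, ψ), Finset.mem_toRight.2 hx, rfl⟩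
      refine Formula.realize_iff.2 (Formula.realize_relabel.trans
        (Iff.trans (iff_of_eq ?_) Formula.realize_relabel.symm))
      exact congrFun ((he 0).trans (he n).symm) ⟨ψ, hψ⟩)
  refine ⟨fun n j => c (n, j), fun P Q hPQ => ?_, fun n ψ => ?_⟩
  · exact (realize_patternFormula _ P Q c).1 (hc _ ⟨Sum.inl ⟨(P, Q), hPQ⟩, trivial, rfl⟩)
  · have := Formula.realize_iff.1 (hc _ ⟨Sum.inr (n, ψ), trivial, rfl⟩)
    rwa [Formula.realize_relabel, Formula.realize_relabel] at this

lemma IsMonster.exists_small_of_not_isNIP_finite (hC : IsMonster L C κ) [Finite α] [Countable β]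
    {φ : L.Formula (α ⊕ β)} (h : ¬ IsNIP C φ) :
    ∃ M : L.ElementarySubstructure C, #M < κ ∧ ∃ (b : β → M) (g : ℕ → (M ≃[L] M)),
      IsIndependentFamily φ fun n j => g n (b j) := by
  obtain ⟨b, hb⟩ := exists_isIndependentFamily_of_not_isNIP h
  obtain ⟨c, hc, hs⟩ := hC.exists_isIndependentFamily_sameType hb
  choose σ hσ using fun n =>
    hC.homogeneous.exists_equiv (mk_range_lt_of_countable hC.aleph0_lt _) (hs n)
  -- Closure under the inverses as well makes each restriction of `σ n` a bijection of `M`.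
  obtain ⟨M, hM, hcM, hf⟩ := hC.exists_small_closed
    (Sum.elim (fun n : ℕ => (σ n : C → C)) fun n : ℕ => ((σ n).symm : C → C)) (Set.range (c 0))
    (Set.countable_range _)
  refine ⟨M, hM, fun j => ⟨c 0 j, hcM ⟨j, rfl⟩⟩,
    fun n => restrictEquiv M (σ n) (hf (Sum.inl n)) (hf (Sum.inr n)), fun P Q hPQ => ?_⟩
  refine HasPattern.of_elementaryEmbedding M.subtype φ ?_
  convert hc P Q hPQ using 1
  funext n j
  exact hσ n j

lemma IsMonster.exists_small_of_not_isNIP (hC : IsMonster L C κ) {φ : L.Formula (α ⊕ β)}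
    (h : ¬ IsNIP C φ) :
    ∃ M : L.ElementarySubstructure C, #M < κ ∧ ∃ (b : β → M) (g : ℕ → (M ≃[L] M)),
      IsIndependentFamily φ fun n j => g n (b j) := by
  classical
  rw [← isNIP_restrictVars] at h
  obtain ⟨M, hM, b', g, hg⟩ := hC.exists_small_of_not_isNIP_finite h
  obtain ⟨b, rfl⟩ := (Subtype.val_injective
    (p := (· ∈ φ.freeVarFinset.toRight))).surjective_comp_right b'
  exact ⟨M, hM, b, g, (isIndependentFamily_restrictVars φ _).1 hg⟩

/-- Tameness of a characteristic function is invariant under isomorphism of models. -/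
lemma isTameFunction_charFun_of_equiv {M N : Type*} [L.Structure M] [L.Structure N] [Nonempty M]
    [Nonempty N] (e : M ≃[L] N) {φ : L.Formula (α ⊕ β)} {b : β → M}
    (h : IsTameFunction (N ≃[L] N) (charFun φ fun j => e (b j))) :
    IsTameFunction (M ≃[L] M) (charFun φ b) := by
  rw [isTameFunction_charFun_iff] at h ⊢
  rintro ⟨g, hg⟩
  refine h ⟨fun n => (e.comp (g n)).comp e.symm, ?_⟩
  convert isIndependentFamily_map_equiv e φ hg using 3 with n j
  exact congrArg (fun x => e (g n x)) (e.symm_apply_apply (b j))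

end Main

end TameNIP

universe u v w w' a b

theorem mainTheorem11 {L : FirstOrder.Language.{u, v}} (T : L.Theory)
    (hT : T.IsComplete) (C : Type w) [L.Structure C] [Nonempty C] [C ⊨ T] (κ : Cardinal.{w})
    (hC : TameNIP.IsMonster L C κ) {α : Type a} {β : Type b} (φ : L.Formula (α ⊕ β)) :
    List.TFAE [
      TameNIP.IsNIP C φ,
      TameNIP.IsTame.{u, v, max w w', a, b} T φ,
      TameNIP.IsSmallTame C κ φ] := by
  tfae_have 1 → 2 := by
    intro h M _ _ _ b
    rw [TameNIP.isTameFunction_charFun_iff]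
    rintro ⟨g, hg⟩
    exact hC.not_isNIP_of_isIndependentFamily (hT.models_elementarily_equivalent C M) hg h
  tfae_have 2 → 3 := by
    intro h M _ b
    -- Small models are models of `T`; only the universe has to be raised, through an isomorphic
    -- copy.
    let S : L.Structure (ULift.{w'} M) := Equiv.inducedStructure Equiv.ulift.symm
    let e : M ≃[L] ULift.{w'} M := Equiv.inducedStructureEquiv Equiv.ulift.symm
    have : ULift.{w'} M ⊨ T := 
      ⟨fun ψ hψ => (Language.StrongHomClass.realize_sentence e ψ).1 (T.realize_sentence_of_mem hψ)⟩
    exact TameNIP.isTameFunction_charFun_of_equiv e (h (ULift.{w'} M) _)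
  tfae_have 3 → 1 := by
    intro h
    by_contra hn
    obtain ⟨M, hM, b, g, hg⟩ := hC.exists_small_of_not_isNIP hn
    exact (TameNIP.isTameFunction_charFun_iff φ b).1 (h M hM b) ⟨g, hg⟩
  tfae_finish
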